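/- Let $m\ge 2$ be an integer and $D=\{0,1,\dots,m-1\}$. For real $\gamma,\lambda$ with $|\gamma|,|\lambda|<1$ let $K_{\gamma,\lambda}\subset\mathbb{R}^2$ be the attractor of the iterated function system $\{(x,y)\mapsto(\gamma x+d,\ \lambda y+d): d\in D\}$, that is, the unique nonempty compact set that equals the union of its images under these maps. Let $\mathcal{B}$ be the set of power series $f(x)=\sum_{i\ge 0}c_i x^i$ with all $c_i\in D-D=\{-(m-1),\dots,m-1\}$ and $c_0\neq 0$. Let $\mathcal{R}\subset\{(\gamma,\lambda)\in\mathbb{R}^2: |\gamma|<|\lambda|<1\}$ be a region of $\star$-transversality: for every $(\gamma,\lambda)\in\mathcal{R}$ there is $f\in\mathcal{B}$ such that $f(\gamma)=f(\lambda)=0$, $f'(\gamma)\neq 0$ and $f'(\lambda)\neq 0$. Then for Lebesgue-almost every $(\gamma,\lambda)\in\mathcal{R}$, $$\mathcal{H}^{d(\gamma,\lambda)}(K_{\gamma,\lambda})=0,\qquad\text{where } d(\gamma,\lambda)=1+\frac{\log (m|\lambda|)}{\log(1/|\gamma|)}$$ and $\mathcal{H}^s$ denotes $s$-dimensional Hausdorff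 measure. (When $0<\gamma<\lambda<1$ the absolute values can be dropped; for $m=2$ the formula is then $1+\log(2\lambda)/\log(1/\gamma)$.) -/

import Mathlib

open Set MeasureTheory Metric
open scoped NNReal ENNReal Pointwise

namespace SelfAffine

/-- The Euclidean plane. -/
abbrev Plane := EuclideanSpace ℝ (Fin 2)

/-- The digit set `D = {0, 1, ..., m - 1}`, as a set of real numbers. -/
def digits (m : ℕ) : Set ℝ := (fun i : ℕ => (i : ℝ)) '' Set.Iio m

/-- The map `(x, y) ↦ (gam * x + d, lam * y + d)`. -/
noncomputable def digitMap (gam lam d : ℝ) (v : Plane) : Plane :=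
  !₂[gam * v 0 + d, lam * v 1 + d]

/-- `K` is the attractor `K_{gam,lam}` of the iterated function system
`{digitMap gam lam d : d ∈ D}`: a nonempty compact set which is the union of its images.
For `|gam|, |lam| < 1` and `m ≥ 1` there is exactly one such set, see `existsUnique_isAttractor`. -/
def IsAttractor (m : ℕ) (gam lam : ℝ) (K : Set Plane) : Prop :=
  K.Nonempty ∧ IsCompact K ∧ K = ⋃ d ∈ digits m, digitMap gam lam d '' K

/-- The coefficient sequences of the class `B` of power series: all coefficients lie in the
difference set `D - D` and the constant term is non-zero. -/
def classB (m : ℕ) : Set (ℕ → ℝ) :=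
  {c | (∀ n, c n ∈ digits m - digits m) ∧ c 0 ≠ 0}

/-- The sum `∑ c n * x ^ n` of the power series (used for `|x| < 1` and bounded coefficients,
where the series converges absolutely). -/
noncomputable def powerSum (c : ℕ → ℝ) (x : ℝ) : ℝ := ∑' n, c n * x ^ n

/-- `R` is a region of ⋆-transversality: for every `(gam, lam) ∈ R` there is a power series in `B`
which has a simple zero at `gam` and a simple zero at `lam`. -/
def IsStarTransversal (m : ℕ) (R : Set (ℝ × ℝ)) : Prop :=
  ∀ p ∈ R, ∃ c ∈ classB m,
    powerSum c p.1 = 0 ∧ powerSum c p.2 = 0 ∧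
      deriv (powerSum c) p.1 ≠ 0 ∧ deriv (powerSum c) p.2 ≠ 0

/-- The critical dimension `1 + log (m |lam|) / log (1 / |gam|)`. -/
noncomputable def critDim (m : ℕ) (gam lam : ℝ) : ℝ :=
  1 + Real.log (m * |lam|) / Real.log (1 / |gam|)

theorem lipschitzWith_digitMap (gam lam d : ℝ) :
    LipschitzWith (max ‖gam‖₊ ‖lam‖₊) (digitMap gam lam d) := by
  refine LipschitzWith.of_dist_le_mul fun x y => ?_
  set c : ℝ := ((max ‖gam‖₊ ‖lam‖₊ : ℝ≥0) : ℝ) with hc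
  have hg : |gam| ≤ c := by simp [hc]
  have hl : |lam| ≤ c := by simp [hc]
  have hc0 : 0 ≤ c := NNReal.coe_nonneg _
  have hg2 : gam ^ 2 ≤ c ^ 2 := sq_le_sq' (by linarith [neg_abs_le gam]) ((le_abs_self _).trans hg)
  have hl2 : lam ^ 2 ≤ c ^ 2 := sq_le_sq' (by linarith [neg_abs_le lam]) ((le_abs_self _).trans hl)
  rw [EuclideanSpace.dist_eq, EuclideanSpace.dist_eq, ← Real.sqrt_sq hc0,
    ← Real.sqrt_mul (sq_nonneg c)]
  refine Real.sqrt_le_sqrt ?_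
  simp only [Fin.sum_univ_two, digitMap, Real.dist_eq, sq_abs]
  simp
  nlinarith [mul_le_mul_of_nonneg_right hg2 (sq_nonneg (x 0 - y 0)),
    mul_le_mul_of_nonneg_right hl2 (sq_nonneg (x 1 - y 1))]

theorem hausdorffEDist_image_le {c : ℝ≥0} {f : Plane → Plane} (hf : LipschitzWith c f)
    {s t : Set Plane} (hs : IsCompact s) (ht : IsCompact t) (hs' : s.Nonempty) (ht' : t.Nonempty) :
    hausdorffEDist (f '' s) (f '' t) ≤ c * hausdorffEDist s t := by
  have key : ∀ {s t : Set Plane}, IsCompact t → t.Nonempty → ∀ x ∈ f '' s,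
      ∃ y ∈ f '' t, edist x y ≤ c * hausdorffEDist s t := by
    rintro s t ht ht' _ ⟨x, hx, rfl⟩
    obtain ⟨y, hy, hxy⟩ := ht.exists_infEDist_eq_edist ht' x
    refine ⟨f y, mem_image_of_mem f hy, (hf x y).trans ?_⟩
    gcongr
    rw [← hxy]
    exact infEDist_le_hausdorffEDist_of_mem hx
  refine hausdorffEDist_le_of_mem_edist (key ht ht') ?_
  rw [hausdorffEDist_comm]
  exact key hs hs'

/-- Well-posedness of the attractor. -/
theorem existsUnique_isAttractor {m : ℕ} (hm : 0 < m) {gam lam : ℝ} (hg : |gam| < 1)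
    (hl : |lam| < 1) : ∃! K : Set Plane, IsAttractor m gam lam K := by
  have hne : (digits m).Nonempty := ⟨_, mem_image_of_mem _ (show (0 : ℕ) ∈ Set.Iio m from hm)⟩
  have hfin : (digits m).Finite := (Set.finite_Iio m).image _
  let F : TopologicalSpace.NonemptyCompacts Plane → TopologicalSpace.NonemptyCompacts Plane :=
    fun K => ⟨⟨⋃ d ∈ digits m, digitMap gam lam d '' K,
      hfin.isCompact_biUnion fun d _ =>
        K.isCompact.image (lipschitzWith_digitMap gam lam d).continuous⟩,
      Set.nonempty_biUnion.2 (hne.imp fun d hd => ⟨hd, K.nonempty.image _⟩)⟩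
  have hF : ContractingWith (max ‖gam‖₊ ‖lam‖₊) F := by
    refine ⟨max_lt (by simpa [← NNReal.coe_lt_coe] using hg)
      (by simpa [← NNReal.coe_lt_coe] using hl), fun s t => ?_⟩
    change hausdorffEDist (⋃ d ∈ digits m, digitMap gam lam d '' (s : Set Plane))
      (⋃ d ∈ digits m, digitMap gam lam d '' (t : Set Plane)) ≤ _
    refine hausdorffEDist_iUnion_le.trans (iSup_le fun d => ?_)
    refine hausdorffEDist_iUnion_le.trans (iSup_le fun _ => ?_)
    exact hausdorffEDist_image_le (lipschitzWith_digitMap gam lam d) s.isCompact t.isCompact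
      s.nonempty t.nonempty
  have : Nonempty (TopologicalSpace.NonemptyCompacts Plane) := ⟨{0}⟩
  refine ⟨(ContractingWith.fixedPoint F hF : TopologicalSpace.NonemptyCompacts Plane),
    ⟨TopologicalSpace.NonemptyCompacts.nonempty _, TopologicalSpace.NonemptyCompacts.isCompact _,
      ?_⟩, ?_⟩
  · exact congrArg (fun K : TopologicalSpace.NonemptyCompacts Plane => (K : Set Plane))
      hF.fixedPoint_isFixedPt.symm
  · rintro K ⟨h1, h2, h3⟩
    have hfix : Function.IsFixedPt F ⟨⟨K, h2⟩, h1⟩ :=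
      TopologicalSpace.NonemptyCompacts.ext h3.symm
    exact congrArg (fun K : TopologicalSpace.NonemptyCompacts Plane => (K : Set Plane))
      (hF.fixedPoint_unique hfix)

end SelfAffine

open Filter Topology

namespace SelfAffine

/-! At level `n`, the attractor is a union of `m ^ n` cylinders of size about `|γ| ^ n × |λ| ^ n`.
Cutting the enclosing rectangles into squares of side `|γ| ^ n` shows that at the critical exponent
each cylinder has content `O(m ^ (-n))`, a bound that is self-consistent but not zero. The gain
comes from cylinders that nearly coincide: one rectangle then covers them all at the price of one.

Near coincidences exist almost everywhere. If `f` in `B` has simple zeros at `γ` and `λ`, its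
degree-`n` truncation is a difference of two words. In each coordinate it is below `ε |x| ^ n` on an
interval of length comparable to `|γ| ^ n`, resp. `|λ| ^ n`, at a comparable distance from the zero
(`eventually_exists_small_truncSum`). So near every point of `R` the open set `overlapSet m ε`
contains a fixed proportion of arbitrarily small rectangles. These have unbounded eccentricity, so
the strong density theorem `ae_strong_density` is needed to conclude that almost every point of `R`
lies in that set (`ae_mem_overlapSet`).

Concatenating near coincidences gives `2 ^ k` nearly coinciding words of one length
(`exists_many_words`). If `b` is the supremum of the normalised contents of cylinders, subdividing
gives `2 ^ k * b ≤ C` with `C` independent of `k`, whence `b = 0` (`content_attractor_eq_zero`). -/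

/-! ### Lebesgue density for eccentric rectangles -/

/-- The points `(x, y)` of `Z` such that the vertical fibre of `Z` over `x` fills at least the
proportion `1 - η` of every interval of rational radius less than `1 / (k + 1)` centred at `y`. -/
def denseFiber (Z : Set (ℝ × ℝ)) (η : ℝ) (k : ℕ) : Set (ℝ × ℝ) :=
  {p | p ∈ Z ∧ ∀ q : ℚ, 0 < q → (q : ℝ) < 1 / ((k : ℝ) + 1) →
    ENNReal.ofReal ((1 - η) * (2 * q)) ≤ volume (Prod.mk p.1 ⁻¹' Z ∩ closedBall p.2 (q : ℝ))}

/-- Rational radii make this a countable intersection, and measures of sections of a measurable set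
depend measurably on the base point. -/
theorem measurableSet_denseFiber {Z : Set (ℝ × ℝ)} (hZ : MeasurableSet Z) (η : ℝ) (k : ℕ) :
    MeasurableSet (denseFiber Z η k) := by
  have h : denseFiber Z η k = Z ∩ ⋂ q : ℚ, ⋂ _ : 0 < q, ⋂ _ : (q : ℝ) < 1 / ((k : ℝ) + 1),
      {p | ENNReal.ofReal ((1 - η) * (2 * q)) ≤
        volume (Prod.mk p.1 ⁻¹' Z ∩ closedBall p.2 (q : ℝ))} := by
    ext p
    simp [denseFiber]
  rw [h]
  refine hZ.inter (MeasurableSet.iInter fun q => MeasurableSet.iInter fun _ =>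
    MeasurableSet.iInter fun _ => measurableSet_le measurable_const ?_)
  have hT : MeasurableSet {a : (ℝ × ℝ) × ℝ | (a.1.1, a.2) ∈ Z ∧ dist a.2 a.1.2 ≤ q} := by
    refine MeasurableSet.inter ?_ ?_
    · exact (measurable_fst.fst.prodMk measurable_snd) hZ
    · exact measurableSet_le (measurable_snd.dist measurable_fst.snd) measurable_const
  exact measurable_measure_prodMk_left hT

theorem exists_nat_density {S : Set ℝ} {x η : ℝ} (hη : 0 < η)
    (h : Tendsto (fun r => volume (S ∩ closedBall x r) / volume (closedBall x r)) (𝓝[>] 0) (𝓝 1)) :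
    ∃ k : ℕ, ∀ q : ℚ, 0 < q → (q : ℝ) < 1 / ((k : ℝ) + 1) →
      ENNReal.ofReal ((1 - η) * (2 * q)) ≤ volume (S ∩ closedBall x (q : ℝ)) := by
  have h1 : ENNReal.ofReal (1 - η) < 1 := by
    rw [← ENNReal.ofReal_one]
    exact (ENNReal.ofReal_lt_ofReal_iff one_pos).2 (by linarith)
  have h2 := h.eventually (lt_mem_nhds h1)
  rw [eventually_nhdsWithin_iff, Metric.eventually_nhds_iff] at h2
  obtain ⟨δ, hδ, h2⟩ := h2
  obtain ⟨k, hk⟩ := exists_nat_one_div_lt hδ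
  refine ⟨k, fun q hq hqk => ?_⟩
  have hq' : (0 : ℝ) < q := by exact_mod_cast hq
  have h3 := h2 (y := (q : ℝ)) (by
    rw [Real.dist_eq, sub_zero, abs_of_pos hq']; exact hqk.trans hk) hq'
  rw [Real.volume_closedBall] at h3
  have h4 := (ENNReal.lt_div_iff_mul_lt
    (Or.inl (by simpa using hq)) (Or.inl ENNReal.ofReal_ne_top)).1 h3
  rw [ENNReal.ofReal_mul' (by positivity)]
  exact h4.le

theorem ae_mem_denseFiber {Z : Set (ℝ × ℝ)} (hZ : MeasurableSet Z) {η : ℝ} (hη : 0 < η) :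
    ∀ᵐ p : ℝ × ℝ, p ∈ Z → ∃ k, p ∈ denseFiber Z η k := by
  have hm : MeasurableSet (Z \ ⋃ k, denseFiber Z η k) :=
    hZ.diff (MeasurableSet.iUnion fun k => measurableSet_denseFiber hZ η k)
  have h0 : volume (Z \ ⋃ k, denseFiber Z η k) = 0 := by
    rw [Measure.volume_eq_prod, Measure.measure_prod_null hm]
    refine Eventually.of_forall fun x => ?_
    have hx : MeasurableSet (Prod.mk x ⁻¹' Z) := measurable_prodMk_left hZ
    have h := (ae_restrict_iff' hx).1
      (Besicovitch.ae_tendsto_measure_inter_div volume (Prod.mk x ⁻¹' Z))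
    refine measure_mono_null ?_ (ae_iff.1 h)
    rintro y ⟨hy, hy'⟩ hh
    obtain ⟨k, hk⟩ := exists_nat_density hη (hh hy)
    exact hy' (mem_iUnion.2 ⟨k, hy, hk⟩)
  refine measure_mono_null ?_ h0
  intro p hp
  simp only [mem_compl_iff, mem_ofPred_eq, Classical.not_imp] at hp
  exact ⟨hp.1, by simpa using hp.2⟩

/-- If the two sets were disjoint, their measures would add up to more than that of the ball. -/
theorem inter_nonempty_of_dense {S J : Set ℝ} {x η η' : ℝ} {r : ℝ} (hr : 0 < r) (hη : η < η')
    (hS : ENNReal.ofReal ((1 - η) * (2 * r)) ≤ volume (S ∩ closedBall x r))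
    (hJm : MeasurableSet J) (hJ : J ⊆ closedBall x r)
    (hJv : ENNReal.ofReal (η' * (2 * r)) ≤ volume J) : (S ∩ J).Nonempty := by
  by_contra hne
  rw [not_nonempty_iff_eq_empty, ← disjoint_iff_inter_eq_empty] at hne
  have h1 : volume (S ∩ closedBall x r) + volume J ≤ volume (closedBall x r) := by
    rw [← measure_union (hne.mono_left inter_subset_left) hJm]
    exact measure_mono (union_subset inter_subset_right hJ)
  have h2 := (add_le_add hS hJv).trans h1
  rw [Real.volume_closedBall] at h2
  have h3 := ENNReal.ofReal_add_le.trans h2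
  rw [ENNReal.ofReal_le_ofReal_iff (by positivity)] at h3
  nlinarith [mul_pos (sub_pos.2 hη) hr]

/-- A strong form of the Lebesgue density theorem, for rectangles of arbitrary eccentricity. -/
theorem ae_strong_density {Z : Set (ℝ × ℝ)} (hZ : MeasurableSet Z) :
    ∀ᵐ p : ℝ × ℝ, p ∈ Z → ∀ η : ℝ, 0 < η → ∃ δ > 0, ∀ q₁ q₂ : ℚ,
      0 < q₁ → (q₁ : ℝ) < δ → 0 < q₂ → (q₂ : ℝ) < δ → ∀ J₁ J₂ : Set ℝ,
      MeasurableSet J₁ → MeasurableSet J₂ →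
      J₁ ⊆ closedBall p.1 (q₁ : ℝ) → J₂ ⊆ closedBall p.2 (q₂ : ℝ) →
      ENNReal.ofReal (η * (2 * q₁)) ≤ volume J₁ → ENNReal.ofReal (η * (2 * q₂)) ≤ volume J₂ →
      (J₁ ×ˢ J₂ ∩ Z).Nonempty := by
  let e : ℕ → ℝ := fun j => 1 / ((j : ℝ) + 1)
  have he : ∀ j, 0 < e j := fun j => by positivity
  have h1 : ∀ᵐ p : ℝ × ℝ, ∀ j, p ∈ Z → ∃ k, p ∈ denseFiber Z (e j) k :=
    ae_all_iff.2 fun j => ae_mem_denseFiber hZ (he j)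
  -- One-dimensional density again, now horizontally, for the set of points whose vertical fibre is
  -- already dense below a fixed scale. Fixing that scale first decouples the two side lengths.
  have h2 : ∀ᵐ p : ℝ × ℝ, ∀ j k, p ∈ denseFiber Z (e j) k →
      ∃ l, p.swap ∈ denseFiber (Prod.swap ⁻¹' denseFiber Z (e j) k) (e j) l := by
    refine ae_all_iff.2 fun j => ae_all_iff.2 fun k => ?_
    have h := ae_mem_denseFiber
      (measurable_swap (measurableSet_denseFiber hZ (e j) k)) (he j)
    exact (Measure.measurePreserving_swap (μ := (volume : Measure ℝ))
      (ν := (volume : Measure ℝ))).quasiMeasurePreserving.ae h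
  filter_upwards [h1, h2] with p h1 h2 hp η hη
  obtain ⟨j, hj⟩ := exists_nat_one_div_lt hη
  obtain ⟨k, hk⟩ := h1 j hp
  obtain ⟨l, hl⟩ := h2 j k hk
  refine ⟨min (1 / ((k : ℝ) + 1)) (1 / ((l : ℝ) + 1)), by positivity, ?_⟩
  intro q₁ q₂ hq₁ hq₁' hq₂ hq₂' J₁ J₂ hm₁ hm₂ hs₁ hs₂ hv₁ hv₂
  -- Choose the abscissa `x` in `J₁` so that the fibre over `x` is still dense around the ordinate
  -- `p.2`; that fibre then meets `J₂`.
  obtain ⟨x, hx, hxJ⟩ := inter_nonempty_of_dense (by exact_mod_cast hq₁) hj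
    (hl.2 q₁ hq₁ (hq₁'.trans_le (min_le_right _ _))) hm₁ hs₁ hv₁
  have hx' : (x, p.2) ∈ denseFiber Z (e j) k := hx
  obtain ⟨y, hy, hyJ⟩ := inter_nonempty_of_dense (by exact_mod_cast hq₂) hj
    (hx'.2 q₂ hq₂ (hq₂'.trans_le (min_le_left _ _))) hm₂ hs₂ hv₂
  exact ⟨(x, y), ⟨hxJ, hyJ⟩, hy⟩


/-! ### Truncated power series near a simple zero -/

/-- The truncation of the power series with coefficients `c` to degree less than `n`. -/
noncomputable def truncSum (c : ℕ → ℝ) (n : ℕ) (x : ℝ) : ℝ := ∑ i ∈ Finset.range n, c i * x ^ i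

theorem abs_powerSum_sub_truncSum_le {c : ℕ → ℝ} {M : ℝ} (hc : ∀ n, |c n| ≤ M) {x : ℝ}
    (hx : |x| < 1) (n : ℕ) : |powerSum c x - truncSum c n x| ≤ M * |x| ^ n * (1 - |x|)⁻¹ := by
  have hb : ∀ i, ‖c i * x ^ i‖ ≤ M * |x| ^ i := fun i => by
    rw [norm_mul, norm_pow, Real.norm_eq_abs, Real.norm_eq_abs]
    exact mul_le_mul_of_nonneg_right (hc i) (by positivity)
  have hs : Summable fun i => c i * x ^ i :=
    Summable.of_norm_bounded ((summable_geometric_of_lt_one (abs_nonneg x) hx).mul_left M) hb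
  have h : powerSum c x - truncSum c n x = ∑' i, c (i + n) * x ^ (i + n) := by
    rw [powerSum, truncSum, ← hs.sum_add_tsum_nat_add n, add_sub_cancel_left]
  rw [h]
  rw [← Real.norm_eq_abs]
  refine tsum_of_norm_bounded
    ((hasSum_geometric_of_lt_one (abs_nonneg x) hx).mul_left (M * |x| ^ n)) fun i => ?_
  refine (hb (i + n)).trans_eq ?_
  ring

theorem exists_lipschitz_truncSum {c : ℕ → ℝ} {M : ℝ} (hc : ∀ n, |c n| ≤ M) {ρ : ℝ} (hρ : 0 < ρ)
    (hρ1 : ρ < 1) : ∃ Λ > 0, ∀ n x y, |x| ≤ ρ → |y| ≤ ρ →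
      |truncSum c n x - truncSum c n y| ≤ Λ * |x - y| := by
  have hM : 0 ≤ M := (abs_nonneg _).trans (hc 0)
  have hs : Summable fun i : ℕ => (i : ℝ) * ρ ^ i := by
    simpa using summable_pow_mul_geometric_of_norm_lt_one 1 (r := ρ)
      (by rwa [Real.norm_eq_abs, abs_of_pos hρ])
  have h0 : 0 ≤ ∑' i : ℕ, (i : ℝ) * ρ ^ i := tsum_nonneg fun i => by positivity
  refine ⟨M * ((∑' i : ℕ, (i : ℝ) * ρ ^ i) / ρ) + 1, by positivity, fun n x y hx hy => ?_⟩
  rw [truncSum, truncSum, ← Finset.sum_sub_distrib]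
  refine (Finset.abs_sum_le_sum_abs _ _).trans ?_
  have h1 : ∀ i ∈ Finset.range n,
      |c i * x ^ i - c i * y ^ i| ≤ (M * |x - y| / ρ) * ((i : ℝ) * ρ ^ i) := by
    intro i _
    rw [← mul_sub, abs_mul]
    have h2 : |x ^ i - y ^ i| ≤ |x - y| * i * ρ ^ (i - 1) :=
      (abs_pow_sub_pow_le x y i).trans (by gcongr; exact max_le hx hy)
    have h3 : (i : ℝ) * ρ ^ (i - 1) = (i : ℝ) * ρ ^ i / ρ := by
      rcases i with _ | i
      · simp
      · rw [Nat.add_sub_cancel, pow_succ]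
        field_simp
    calc |c i| * |x ^ i - y ^ i| ≤ M * (|x - y| * i * ρ ^ (i - 1)) :=
          mul_le_mul (hc i) h2 (abs_nonneg _) hM
      _ = M * |x - y| * ((i : ℝ) * ρ ^ (i - 1)) := by ring
      _ = _ := by rw [h3]; ring
  refine (Finset.sum_le_sum h1).trans ?_
  rw [← Finset.mul_sum]
  have h4 := hs.sum_le_tsum (Finset.range n) fun i _ => by positivity
  calc M * |x - y| / ρ * ∑ i ∈ Finset.range n, (i : ℝ) * ρ ^ i
      ≤ M * |x - y| / ρ * ∑' i : ℕ, (i : ℝ) * ρ ^ i := by gcongr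
    _ = M * ((∑' i : ℕ, (i : ℝ) * ρ ^ i) / ρ) * |x - y| := by ring
    _ ≤ _ := by gcongr; linarith

/-- The relative error `δ` of `b` is `O(a ^ n)`, so `n * δ` tends to zero and `(1 ± δ) ^ n` stays
within a factor of two of one. -/
theorem eventually_pow_comparable {a : ℝ} (ha : 0 < a) (ha1 : a < 1) {C : ℝ} (hC : 0 < C) :
    ∀ᶠ n : ℕ in atTop, ∀ b : ℝ, |b - a| ≤ C * a ^ n → a ^ n ≤ 2 * b ^ n ∧ b ^ n ≤ 2 * a ^ n := by
  have ht : Tendsto (fun n : ℕ => C / a * ((n : ℝ) * a ^ n)) atTop (𝓝 0) := by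
    simpa using (tendsto_self_mul_const_pow_of_abs_lt_one
      (by rwa [abs_of_pos ha])).const_mul (C / a)
  filter_upwards [ht.eventually (ge_mem_nhds (show (0 : ℝ) < 1 / 2 by norm_num)),
    eventually_ge_atTop 1] with n hn hn1 b hb
  set δ : ℝ := C / a * a ^ n with hδ
  have hδ0 : 0 < δ := by positivity
  have hnδ : n * δ ≤ 1 / 2 := by rw [hδ]; linarith
  have hn1' : (1 : ℝ) ≤ n := by exact_mod_cast hn1
  have hδ1 : δ ≤ 1 / 2 := by nlinarith
  have haδ : C * a ^ n = a * δ := by rw [hδ]; field_simp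
  rw [haδ, abs_le] at hb
  have h1 : a * (1 - δ) ≤ b := by linarith
  have h2 : b ≤ a * (1 + δ) := by linarith
  have hb0 : 0 ≤ b := le_trans (mul_nonneg ha.le (by linarith)) h1
  have han : 0 < a ^ n := by positivity
  constructor
  · have h3 : a ^ n * (1 - δ) ^ n ≤ b ^ n := by
      rw [← mul_pow]
      exact pow_le_pow_left₀ (mul_nonneg ha.le (by linarith)) h1 n
    have h4 : 1 + n * (-δ) ≤ (1 + -δ) ^ n := one_add_mul_le_pow (by linarith) n
    rw [← sub_eq_add_neg] at h4
    nlinarith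
  · have h3 : b ^ n ≤ a ^ n * (1 + δ) ^ n := by
      rw [← mul_pow]
      exact pow_le_pow_left₀ hb0 h2 n
    have h4 : (1 + δ) ^ n ≤ Real.exp (n * δ) := by
      rw [Real.exp_nat_mul]
      exact pow_le_pow_left₀ (by linarith) (by linarith [Real.add_one_le_exp δ]) n
    have h5 : Real.exp (n * δ) ≤ 2 := by
      rw [← Real.le_log_iff_exp_le two_pos]
      linarith [Real.log_two_gt_d9]
    nlinarith

/-- Near a simple zero `x₀` of a power series, the truncation of degree `n` is small on an interval
of length comparable to `|x₀| ^ n` at distance `O(|x₀| ^ n)` from `x₀`. -/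
theorem eventually_exists_small_truncSum {c : ℕ → ℝ} {M : ℝ} (hc : ∀ n, |c n| ≤ M) {x₀ : ℝ}
    (hx₀ : x₀ ≠ 0) (hx₁ : |x₀| < 1) (hz : powerSum c x₀ = 0) (hd : deriv (powerSum c) x₀ ≠ 0)
    {ε : ℝ} (hε : 0 < ε) : ∃ κ > 0, ∃ C > 0, ∀ᶠ n : ℕ in atTop, ∃ z : ℝ,
      closedBall z (κ * |x₀| ^ n) ⊆ closedBall x₀ (C * |x₀| ^ n) ∧
      ∀ x ∈ closedBall z (κ * |x₀| ^ n), |truncSum c n x| < ε * |x| ^ n := by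
  obtain ⟨ρ, hρ, hρ1⟩ := exists_between hx₁
  have ha : 0 < |x₀| := abs_pos.2 hx₀
  have hρ0 : 0 < ρ := ha.trans hρ
  have hM : 0 ≤ M := (abs_nonneg _).trans (hc 0)
  obtain ⟨Λ, hΛ, hLip⟩ := exists_lipschitz_truncSum hc hρ0 hρ1
  set α := deriv (powerSum c) x₀ with hα
  have hα0 : 0 < |α| := abs_pos.2 hd
  have hder : HasDerivAt (powerSum c) α x₀ := (differentiableAt_of_deriv_ne_zero hd).hasDerivAt
  set B : ℝ := 2 * M * (1 - ρ)⁻¹ + 1 with hB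
  have hB0 : 0 < B := by
    have : 0 < 1 - ρ := by linarith
    positivity
  -- At distance `C * |x₀| ^ n` from `x₀` the tail, at most `B * |x₀| ^ n`, is a quarter of the
  -- linear term. The linearisation error is at most another quarter, so the truncation has the sign
  -- of the linear term.
  set C : ℝ := 4 * B / |α| with hC
  have hC0 : 0 < C := by positivity
  set κ : ℝ := ε / (4 * Λ) with hκ
  have hκ0 : 0 < κ := by positivity
  refine ⟨κ, hκ0, C + κ, by positivity, ?_⟩
  have hlin := hder.isLittleO.def (show 0 < |α| / 4 by positivity)
  rw [Metric.eventually_nhds_iff] at hlin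
  obtain ⟨δ, hδ, hlin⟩ := hlin
  have ht : Tendsto (fun n : ℕ => (C + κ) * |x₀| ^ n) atTop (𝓝 0) := by
    simpa using (tendsto_pow_atTop_nhds_zero_of_lt_one ha.le hx₁).const_mul (C + κ)
  filter_upwards [ht.eventually (gt_mem_nhds hδ), ht.eventually (gt_mem_nhds (sub_pos.2 hρ)),
    eventually_pow_comparable ha hx₁ (show 0 < C + κ by positivity)] with n hn1 hn2 hn3
  have han : 0 < |x₀| ^ n := by positivity
  have hnear : ∀ x, |x - x₀| ≤ (C + κ) * |x₀| ^ n →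
      |x| ≤ ρ ∧ |x₀| ^ n ≤ 2 * |x| ^ n ∧ |x| ^ n ≤ 2 * |x₀| ^ n := by
    intro x hx
    have h1 : |(|x| - |x₀|)| ≤ |x - x₀| := abs_abs_sub_abs_le_abs_sub x x₀
    refine ⟨?_, hn3 _ (h1.trans hx)⟩
    linarith [le_abs_self (|x| - |x₀|)]
  have hCn : C * |x₀| ^ n < (C + κ) * |x₀| ^ n := by nlinarith
  have hmain : ∀ x, |x - x₀| = C * |x₀| ^ n →
      |truncSum c n x - α * (x - x₀)| ≤ |α| / 2 * (C * |x₀| ^ n) := by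
    intro x hx
    obtain ⟨h1, -, h2⟩ := hnear x (hx.trans_le hCn.le)
    have h3 := hlin (y := x) (by rw [Real.dist_eq, hx]; linarith)
    rw [hz, sub_zero, smul_eq_mul, Real.norm_eq_abs, Real.norm_eq_abs, hx,
      mul_comm (x - x₀) α] at h3
    have h4 := abs_powerSum_sub_truncSum_le hc (h1.trans_lt hρ1) n
    have h5 : M * |x| ^ n * (1 - |x|)⁻¹ ≤ B * |x₀| ^ n := by
      have h6 : (1 - |x|)⁻¹ ≤ (1 - ρ)⁻¹ := inv_anti₀ (by linarith) (by linarith)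
      have h7 : 0 < (1 - ρ)⁻¹ := inv_pos.2 (by linarith)
      calc M * |x| ^ n * (1 - |x|)⁻¹ ≤ M * (2 * |x₀| ^ n) * (1 - ρ)⁻¹ :=
            mul_le_mul (by gcongr) h6 (inv_nonneg.2 (by linarith)) (by positivity)
        _ = (2 * M * (1 - ρ)⁻¹) * |x₀| ^ n := by ring
        _ ≤ _ := by gcongr; linarith
    have h6 : B * |x₀| ^ n = |α| / 4 * (C * |x₀| ^ n) := by
      rw [hC]; field_simp
    rw [abs_le] at h3 h4 ⊢
    constructor <;> linarith [h3.1, h3.2, h4.1, h4.2]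
  have hp := hmain (x₀ + C * |x₀| ^ n) (by rw [add_sub_cancel_left]; exact abs_of_pos (by positivity))
  have hm := hmain (x₀ - C * |x₀| ^ n) (by
    rw [show x₀ - C * |x₀| ^ n - x₀ = -(C * |x₀| ^ n) by ring, abs_neg]
    exact abs_of_pos (by positivity))
  -- Multiplying by `α` fixes the direction of the sign change, so both signs of the derivative are
  -- treated at once.
  have hcont : Continuous fun x => α * truncSum c n x := by
    unfold truncSum
    fun_prop
  have hr : 0 < C * |x₀| ^ n := by positivity
  obtain ⟨z, hzI, hz0⟩ : (0 : ℝ) ∈ (fun x => α * truncSum c n x) ''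
      Icc (x₀ - C * |x₀| ^ n) (x₀ + C * |x₀| ^ n) := by
    refine intermediate_value_Icc (by linarith) hcont.continuousOn ?_
    have hαα : |α| * |α| = α * α := abs_mul_abs_self α
    have key : ∀ t s : ℝ, |t - α * s| ≤ |α| / 2 * (C * |x₀| ^ n) →
        |α * t - α * α * s| ≤ α * α / 2 * (C * |x₀| ^ n) := by
      intro t s h
      rw [show α * t - α * α * s = α * (t - α * s) by ring, abs_mul, ← hαα]
      calc |α| * |t - α * s| ≤ |α| * (|α| / 2 * (C * |x₀| ^ n)) := by gcongr
        _ = _ := by ring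
    have hp' := abs_le.1 (key _ _ hp)
    have hm' := abs_le.1 (key _ _ hm)
    have hα2 : 0 < α * α := by rw [← hαα]; positivity
    have := mul_pos hα2 hr
    constructor
    · change α * truncSum c n (x₀ - C * |x₀| ^ n) ≤ 0
      nlinarith [hm'.2]
    · change 0 ≤ α * truncSum c n (x₀ + C * |x₀| ^ n)
      nlinarith [hp'.1]
  have hz0' : truncSum c n z = 0 := (mul_eq_zero.1 hz0).resolve_left hd
  have hzx : |z - x₀| ≤ C * |x₀| ^ n := abs_le.2 ⟨by linarith [hzI.1], by linarith [hzI.2]⟩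
  have hball : ∀ x ∈ closedBall z (κ * |x₀| ^ n), |x - x₀| ≤ (C + κ) * |x₀| ^ n := by
    intro x hx
    rw [mem_closedBall, Real.dist_eq] at hx
    have := abs_sub_le x z x₀
    linarith
  refine ⟨z, fun x hx => by rw [mem_closedBall, Real.dist_eq]; exact hball x hx, fun x hx => ?_⟩
  obtain ⟨h1, h2, -⟩ := hnear x (hball x hx)
  have h3 := hLip n x z h1 (hnear z (hzx.trans hCn.le)).1
  rw [mem_closedBall, Real.dist_eq] at hx
  rw [hz0', sub_zero] at h3
  have h4 : Λ * |x - z| ≤ Λ * (κ * |x₀| ^ n) := by gcongr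
  have h5 : Λ * (κ * |x₀| ^ n) = ε / 4 * |x₀| ^ n := by rw [hκ]; field_simp
  nlinarith


/-! ### Near coincidences of cylinders for almost every parameter -/

/-- The value at `x` of the polynomial whose coefficients are the letters of the word `w`. -/
noncomputable def wordSum {m n : ℕ} (w : Fin n → Fin m) (x : ℝ) : ℝ :=
  ∑ i, ((w i : ℕ) : ℝ) * x ^ (i : ℕ)

/-- The parameters for which two distinct cylinders of some common level `n` nearly coincide, up
to a proportion `ε` of their size. -/
def overlapSet (m : ℕ) (ε : ℝ) : Set (ℝ × ℝ) :=
  {p | ∃ n, ∃ u v : Fin n → Fin m, u ≠ v ∧ |wordSum u p.1 - wordSum v p.1| < ε * |p.1| ^ n ∧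
    |wordSum u p.2 - wordSum v p.2| < ε * |p.2| ^ n}

theorem continuous_wordSum {m n : ℕ} (w : Fin n → Fin m) : Continuous (wordSum w) := by
  unfold wordSum
  fun_prop

theorem isOpen_overlapSet (m : ℕ) (ε : ℝ) : IsOpen (overlapSet m ε) := by
  have h : overlapSet m ε = ⋃ n, ⋃ u : Fin n → Fin m, ⋃ v : Fin n → Fin m, ⋃ _ : u ≠ v,
      {p | |wordSum u p.1 - wordSum v p.1| < ε * |p.1| ^ n} ∩
      {p | |wordSum u p.2 - wordSum v p.2| < ε * |p.2| ^ n} := by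
    ext p
    simp [overlapSet, and_left_comm]
  rw [h]
  refine isOpen_iUnion fun n => isOpen_iUnion fun u => isOpen_iUnion fun v =>
    isOpen_iUnion fun _ => IsOpen.inter ?_ ?_
  · have hu := continuous_wordSum u
    have hv := continuous_wordSum v
    exact isOpen_lt (by fun_prop) (by fun_prop)
  · have hu := continuous_wordSum u
    have hv := continuous_wordSum v
    exact isOpen_lt (by fun_prop) (by fun_prop)

theorem abs_le_of_mem_digits_sub {m : ℕ} {c : ℝ} (hc : c ∈ digits m - digits m) :
    |c| ≤ (m : ℝ) - 1 := by
  obtain ⟨_, ⟨i, hi, rfl⟩, _, ⟨j, hj, rfl⟩, rfl⟩ := hc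
  have hi' : (i : ℝ) + 1 ≤ m := by exact_mod_cast Nat.succ_le_of_lt hi
  have hj' : (j : ℝ) + 1 ≤ m := by exact_mod_cast Nat.succ_le_of_lt hj
  have hi0 : (0 : ℝ) ≤ i := i.cast_nonneg
  have hj0 : (0 : ℝ) ≤ j := j.cast_nonneg
  rw [abs_le]
  constructor <;> simp only <;> linarith

theorem one_le_abs_of_mem_digits_sub {m : ℕ} {c : ℝ} (hc : c ∈ digits m - digits m)
    (h0 : c ≠ 0) : 1 ≤ |c| := by
  obtain ⟨_, ⟨i, hi, rfl⟩, _, ⟨j, hj, rfl⟩, rfl⟩ := hc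
  have h : ((i : ℤ) - j : ℤ) ≠ 0 := by
    intro h
    apply h0
    simp only
    exact_mod_cast congrArg (Int.cast : ℤ → ℝ) h
  have := Int.one_le_abs h
  simp only
  exact_mod_cast (Int.cast_le (R := ℝ)).2 this

theorem exists_words_truncSum {m : ℕ} {c : ℕ → ℝ} (hc : c ∈ classB m) {n : ℕ} (hn : 1 ≤ n) :
    ∃ u v : Fin n → Fin m, u ≠ v ∧ ∀ x, wordSum u x - wordSum v x = truncSum c n x := by
  have h : ∀ i, ∃ a b : Fin m, ((a : ℕ) : ℝ) - ((b : ℕ) : ℝ) = c i := fun i => by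
    obtain ⟨_, ⟨a, ha, rfl⟩, _, ⟨b, hb, rfl⟩, h⟩ := hc.1 i
    exact ⟨⟨a, ha⟩, ⟨b, hb⟩, h⟩
  choose a b hab using h
  refine ⟨fun i => a i, fun i => b i, fun h => hc.2 ?_, fun x => ?_⟩
  · have := congrFun h ⟨0, hn⟩
    rw [← hab 0, sub_eq_zero]
    exact congrArg (fun k : Fin m => ((k : ℕ) : ℝ)) this
  · rw [wordSum, wordSum, truncSum, ← Finset.sum_sub_distrib, Finset.sum_range]
    refine Finset.sum_congr rfl fun i _ => ?_
    rw [← hab, sub_mul]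

theorem ne_zero_of_powerSum_eq_zero {c : ℕ → ℝ} (h0 : c 0 ≠ 0) {x : ℝ}
    (hx : powerSum c x = 0) : x ≠ 0 := by
  rintro rfl
  apply h0
  rw [← hx, powerSum, tsum_eq_single 0 fun n hn => by simp [hn]]
  simp

/-- The constant term, of modulus at least one, must be cancelled by a tail of at most `(m - 1) |x|
/ (1 - |x|)`. This makes the critical exponent nonnegative. -/
theorem one_le_mul_abs_of_powerSum_eq_zero {m : ℕ} {c : ℕ → ℝ} (hc : c ∈ classB m) {x : ℝ}
    (hx1 : |x| < 1) (hx : powerSum c x = 0) : 1 ≤ m * |x| := by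
  have h1 := abs_powerSum_sub_truncSum_le (fun n => abs_le_of_mem_digits_sub (hc.1 n)) hx1 1
  have h2 := one_le_abs_of_mem_digits_sub (hc.1 0) hc.2
  have h3 : 0 < 1 - |x| := by linarith
  simp only [hx, truncSum, Finset.sum_range_one, pow_zero, mul_one, zero_sub, abs_neg,
    pow_one] at h1
  have h4 := h2.trans h1
  rw [← div_eq_mul_inv, le_div_iff₀ h3] at h4
  linarith

/-- Almost every point of a region of ⋆-transversality admits nearly coinciding cylinders. -/
theorem ae_mem_overlapSet {m : ℕ} {R : Set (ℝ × ℝ)} (hR : ∀ p ∈ R, |p.1| < 1 ∧ |p.2| < 1)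
    (hT : IsStarTransversal m R) {ε : ℝ} (hε : 0 < ε) :
    ∀ᵐ p : ℝ × ℝ, p ∈ R → p ∈ overlapSet m ε := by
  filter_upwards [ae_strong_density (isOpen_overlapSet m ε).measurableSet.compl] with p hp hpR
  by_contra hpZ
  obtain ⟨c, hc, hz1, hz2, hd1, hd2⟩ := hT p hpR
  have hcM := fun n => abs_le_of_mem_digits_sub (hc.1 n)
  have hx1 := ne_zero_of_powerSum_eq_zero hc.2 hz1
  have hx2 := ne_zero_of_powerSum_eq_zero hc.2 hz2
  obtain ⟨κ₁, hκ₁, C₁, hC₁, h₁⟩ :=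
    eventually_exists_small_truncSum hcM hx1 (hR p hpR).1 hz1 hd1 hε
  obtain ⟨κ₂, hκ₂, C₂, hC₂, h₂⟩ :=
    eventually_exists_small_truncSum hcM hx2 (hR p hpR).2 hz2 hd2 hε
  obtain ⟨δ, hδ, hdens⟩ := hp hpZ (min (κ₁ / (2 * C₁)) (κ₂ / (2 * C₂))) (by positivity)
  have ht : ∀ (C a : ℝ), |a| < 1 → ∀ᶠ n : ℕ in atTop, 2 * C * |a| ^ n < δ := fun C a ha => by
    have : Tendsto (fun n : ℕ => 2 * C * |a| ^ n) atTop (𝓝 0) := by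
      simpa using (tendsto_pow_atTop_nhds_zero_of_lt_one (abs_nonneg a) ha).const_mul (2 * C)
    exact this.eventually (gt_mem_nhds hδ)
  obtain ⟨n, ⟨z₁, hb₁, hs₁⟩, ⟨z₂, hb₂, hs₂⟩, hn₁, hn₂, hn⟩ := (h₁.and (h₂.and
    ((ht C₁ _ (hR p hpR).1).and ((ht C₂ _ (hR p hpR).2).and (eventually_ge_atTop 1))))).exists
  -- A rational radius between `C * |a| ^ n` and `2 * C * |a| ^ n` costs at most a factor of two in
  -- the proportion, hence `κ / (2 * C)`.
  have hq : ∀ {κ C a η : ℝ}, 0 < κ → 0 < C → a ≠ 0 → 2 * C * |a| ^ n < δ → 0 < η →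
      η ≤ κ / (2 * C) → ∃ q : ℚ, 0 < q ∧ (q : ℝ) < δ ∧ C * |a| ^ n ≤ q ∧
        ∀ z : ℝ, ENNReal.ofReal (η * (2 * q)) ≤ volume (closedBall z (κ * |a| ^ n)) := by
    intro κ C a η hκ hC ha hn hη hηκ
    have han : 0 < |a| ^ n := pow_pos (abs_pos.2 ha) n
    have hlt : C * |a| ^ n < 2 * C * |a| ^ n := by nlinarith [mul_pos hC han]
    obtain ⟨q, hq1, hq2⟩ := exists_rat_btwn hlt
    have hq0 : (0 : ℝ) < q := (mul_pos hC han).trans hq1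
    refine ⟨q, by exact_mod_cast hq0, hq2.trans hn, hq1.le, fun z => ?_⟩
    rw [Real.volume_closedBall]
    refine ENNReal.ofReal_le_ofReal ?_
    have : η * q ≤ κ / (2 * C) * (2 * C * |a| ^ n) :=
      mul_le_mul hηκ hq2.le hq0.le (by positivity)
    have h2 : κ / (2 * C) * (2 * C * |a| ^ n) = κ * |a| ^ n := by field_simp
    linarith
  have hη : 0 < min (κ₁ / (2 * C₁)) (κ₂ / (2 * C₂)) := by positivity
  obtain ⟨q₁, hq₁, hqδ₁, hCq₁, hv₁⟩ := hq hκ₁ hC₁ hx1 hn₁ hη (min_le_left _ _)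
  obtain ⟨q₂, hq₂, hqδ₂, hCq₂, hv₂⟩ := hq hκ₂ hC₂ hx2 hn₂ hη (min_le_right _ _)
  -- Density yields a point outside the overlap set at which both truncations are small, which is
  -- contradictory.
  obtain ⟨y, ⟨hy1, hy2⟩, hyZ⟩ := hdens q₁ q₂ hq₁ hqδ₁ hq₂ hqδ₂ _ _ measurableSet_closedBall
    measurableSet_closedBall (hb₁.trans (closedBall_subset_closedBall hCq₁))
    (hb₂.trans (closedBall_subset_closedBall hCq₂)) (hv₁ z₁) (hv₂ z₂)
  obtain ⟨u, v, huv, hsum⟩ := exists_words_truncSum hc hn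
  refine hyZ ⟨n, u, v, huv, ?_, ?_⟩
  · rw [hsum]
    exact hs₁ _ hy1
  · rw [hsum]
    exact hs₂ _ hy2


/-! ### Multiplying near coincidences by concatenation -/

theorem wordSum_append {m n k : ℕ} (u : Fin n → Fin m) (v : Fin k → Fin m) (x : ℝ) :
    wordSum (Fin.append u v) x = wordSum u x + x ^ n * wordSum v x := by
  simp only [wordSum, Fin.sum_univ_add, Fin.append_left, Fin.append_right, Fin.val_castAdd,
    Fin.val_natAdd, pow_add, Finset.mul_sum]
  congr 1
  exact Finset.sum_congr rfl fun i _ => by ring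

theorem wordSum_snoc {m n : ℕ} (u : Fin n → Fin m) (d : Fin m) (x : ℝ) :
    wordSum (Fin.snoc u d : Fin (n + 1) → Fin m) x = wordSum u x + ((d : ℕ) : ℝ) * x ^ n := by
  simp [wordSum, Fin.sum_univ_castSucc]

/-- Iterating near coincidences of two cylinders yields arbitrarily many nearly coinciding
cylinders of a common level. -/
theorem exists_many_words {m : ℕ} {g l : ℝ} (hg : 0 < |g|) (hgl : |g| ≤ |l|)
    (h : ∀ ε > 0, (g, l) ∈ overlapSet m ε) (k : ℕ) : ∀ ε > 0, ∃ L, ∃ W : Finset (Fin L → Fin m),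
      2 ^ k ≤ W.card ∧ ∀ w ∈ W, ∀ w' ∈ W, |wordSum w g - wordSum w' g| ≤ ε * |g| ^ L ∧
        |wordSum w l - wordSum w' l| ≤ ε * |l| ^ L := by
  induction k with
  | zero =>
    intro ε hε
    refine ⟨0, Finset.univ, by simp, fun w _ w' _ => ?_⟩
    rw [Subsingleton.elim w w']
    simp [hε.le]
  | succ k ih =>
    intro ε hε
    obtain ⟨L, W, hW, hWε⟩ := ih (ε / 2) (by positivity)
    -- The prefixes must agree at the finer scale of level `n + L`. The factor `|g| ^ L` ensures
    -- this in both coordinates, since `|g| ≤ |l|`.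
    obtain ⟨n, u, v, huv, h1, h2⟩ := h (ε / 2 * |g| ^ L) (by positivity)
    refine ⟨n + L, (({u, v} : Finset (Fin n → Fin m)) ×ˢ W).map
      (Fin.appendEquiv n L).toEmbedding, ?_, ?_⟩
    · rw [Finset.card_map, Finset.card_product, Finset.card_pair huv, pow_succ']
      exact Nat.mul_le_mul_left 2 hW
    have hpair : ∀ x δ : ℝ, 0 ≤ δ → |wordSum u x - wordSum v x| ≤ δ →
        ∀ a ∈ ({u, v} : Finset (Fin n → Fin m)), ∀ b ∈ ({u, v} : Finset (Fin n → Fin m)),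
          |wordSum a x - wordSum b x| ≤ δ := by
      intro x δ hδ hx a ha b hb
      simp only [Finset.mem_insert, Finset.mem_singleton] at ha hb
      rcases ha with rfl | rfl <;> rcases hb with rfl | rfl
      · simpa using hδ
      · exact hx
      · rwa [abs_sub_comm]
      · simpa using hδ
    have hstep : ∀ x : ℝ, |g| ≤ |x| → |wordSum u x - wordSum v x| < ε / 2 * |g| ^ L * |x| ^ n →
        ∀ a ∈ ({u, v} : Finset (Fin n → Fin m)), ∀ b ∈ ({u, v} : Finset (Fin n → Fin m)),
        ∀ w w' : Fin L → Fin m, |wordSum w x - wordSum w' x| ≤ ε / 2 * |x| ^ L →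
        |wordSum (Fin.append a w) x - wordSum (Fin.append b w') x| ≤ ε * |x| ^ (n + L) := by
      intro x hx hlt a ha b hb w w' hw
      have hab := hpair x _ (by positivity) hlt.le a ha b hb
      rw [wordSum_append, wordSum_append,
        show wordSum a x + x ^ n * wordSum w x - (wordSum b x + x ^ n * wordSum w' x) =
          (wordSum a x - wordSum b x) + x ^ n * (wordSum w x - wordSum w' x) by ring]
      refine (abs_add_le _ _).trans ?_
      rw [abs_mul, abs_pow]
      have h3 : |x| ^ n * |wordSum w x - wordSum w' x| ≤ |x| ^ n * (ε / 2 * |x| ^ L) := by gcongr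
      have h4 : ε / 2 * |g| ^ L * |x| ^ n ≤ ε / 2 * |x| ^ L * |x| ^ n := by gcongr
      rw [pow_add]
      linarith
    intro w hw w' hw'
    simp only [Finset.mem_map, Finset.mem_product, Equiv.coe_toEmbedding, Prod.exists] at hw hw'
    obtain ⟨a, x, ⟨ha, hx⟩, rfl⟩ := hw
    obtain ⟨b, y, ⟨hb, hy⟩, rfl⟩ := hw'
    exact ⟨hstep g le_rfl h1 a ha b hb x y (hWε x hx y hy).1,
      hstep l hgl h2 a ha b hb x y (hWε x hx y hy).2⟩

/-! ### Cylinders and covering rectangles -/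

/-- The translate by `t` of the image of `K` under the diagonal matrix with entries `g ^ n` and
`l ^ n`. -/
def cylinder (g l : ℝ) (K : Set Plane) (n : ℕ) (t : ℝ × ℝ) : Set Plane :=
  {v | ∃ y ∈ K, v 0 = t.1 + g ^ n * y 0 ∧ v 1 = t.2 + l ^ n * y 1}

/-- The closed coordinate rectangle with centre `t` and half-sides `a` and `b`. -/
def rectangle (t : ℝ × ℝ) (a b : ℝ) : Set Plane := {v | |v 0 - t.1| ≤ a ∧ |v 1 - t.2| ≤ b}

theorem IsAttractor.exists_word {m : ℕ} {g l : ℝ} {K : Set Plane} (hK : IsAttractor m g l K)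
    (n : ℕ) {v : Plane} (hv : v ∈ K) : ∃ w : Fin n → Fin m,
      v ∈ cylinder g l K n (wordSum w g, wordSum w l) := by
  induction n with
  | zero => exact ⟨Fin.elim0, v, hv, by simp [wordSum], by simp [wordSum]⟩
  | succ n ih =>
    obtain ⟨w, y, hy, h0, h1⟩ := ih
    rw [hK.2.2] at hy
    simp only [mem_iUnion] at hy
    obtain ⟨_, ⟨d, hd, rfl⟩, z, hz, rfl⟩ := hy
    refine ⟨Fin.snoc w ⟨d, hd⟩, z, hz, ?_, ?_⟩
    · rw [h0]
      simp only [digitMap, wordSum_snoc]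
      simp
      ring
    · rw [h1]
      simp only [digitMap, wordSum_snoc]
      simp
      ring

theorem IsAttractor.cylinder_subset {m : ℕ} {g l : ℝ} {K : Set Plane} (hK : IsAttractor m g l K)
    (n L : ℕ) (t : ℝ × ℝ) : cylinder g l K n t ⊆ ⋃ w : Fin L → Fin m,
      cylinder g l K (n + L) (t.1 + g ^ n * wordSum w g, t.2 + l ^ n * wordSum w l) := by
  rintro v ⟨y, hy, h0, h1⟩
  obtain ⟨w, z, hz, hz0, hz1⟩ := hK.exists_word L hy
  refine mem_iUnion.2 ⟨w, z, hz, ?_, ?_⟩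
  · rw [h0, hz0, pow_add]
    ring
  · rw [h1, hz1, pow_add]
    ring

theorem IsAttractor.exists_bound {m : ℕ} {g l : ℝ} {K : Set Plane} (hK : IsAttractor m g l K) :
    ∃ B > 0, ∀ y ∈ K, |y 0| ≤ B ∧ |y 1| ≤ B := by
  obtain ⟨B, hB, h⟩ := hK.2.1.isBounded.exists_pos_norm_le
  exact ⟨B, hB, fun y hy => ⟨(PiLp.norm_apply_le y 0).trans (h y hy),
    (PiLp.norm_apply_le y 1).trans (h y hy)⟩⟩

theorem cylinder_subset_rectangle {g l B δ : ℝ} {K : Set Plane}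
    (hB : ∀ y ∈ K, |y 0| ≤ B ∧ |y 1| ≤ B) {n : ℕ} {t t' : ℝ × ℝ}
    (h0 : |t.1 - t'.1| ≤ δ * |g| ^ n) (h1 : |t.2 - t'.2| ≤ δ * |l| ^ n) :
    cylinder g l K n t ⊆ rectangle t' ((B + δ) * |g| ^ n) ((B + δ) * |l| ^ n) := by
  have key : ∀ {a x b b' y : ℝ}, |b - b'| ≤ δ * |a| ^ n → |y| ≤ B → x = b + a ^ n * y →
      |x - b'| ≤ (B + δ) * |a| ^ n := by
    rintro a x b b' y hb hy rfl
    rw [show b + a ^ n * y - b' = (b - b') + a ^ n * y by ring]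
    refine (abs_add_le _ _).trans ?_
    rw [abs_mul, abs_pow]
    have : |a| ^ n * |y| ≤ |a| ^ n * B := by gcongr
    linarith
  rintro v ⟨y, hy, hv0, hv1⟩
  exact ⟨key h0 (hB y hy).1 hv0, key h1 (hB y hy).2 hv1⟩

theorem edist_le_of_abs_le {v w : Plane} {a b : ℝ} (h0 : |v 0 - w 0| ≤ a) (h1 : |v 1 - w 1| ≤ b) :
    edist v w ≤ ENNReal.ofReal (a + b) := by
  rw [edist_dist, EuclideanSpace.dist_eq]
  refine ENNReal.ofReal_le_ofReal (Real.sqrt_le_iff.2 ⟨?_, ?_⟩)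
  · linarith [abs_nonneg (v 0 - w 0), abs_nonneg (v 1 - w 1)]
  · simp only [Fin.sum_univ_two, Real.dist_eq]
    nlinarith [abs_nonneg (v 0 - w 0), abs_nonneg (v 1 - w 1)]

/-- The pre-Hausdorff content, with covering sets of diameter at most `r`. -/
noncomputable abbrev content (s : ℝ) (r : ℝ≥0∞) : OuterMeasure Plane :=
  OuterMeasure.mkMetric'.pre (fun S => ediam S ^ s) r

/-- Slice the long side into pieces of length `h`: at most `(2 * M + 1) * (H / h)` boxes are needed,
each of diameter at most `(2 * M + 1) * h`. -/
theorem content_rectangle_le {s : ℝ} (hs : 0 ≤ s) {r : ℝ≥0∞} {M h H : ℝ} (hM : 0 < M) (hh : 0 < h)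
    (hH : h ≤ H) (hr : ENNReal.ofReal ((2 * M + 1) * h) ≤ r) (t : ℝ × ℝ) :
    content s r (rectangle t (M * h) (M * H)) ≤
      ENNReal.ofReal ((2 * M + 1) * (H / h) * ((2 * M + 1) * h) ^ s) := by
  set J : ℕ := ⌊2 * M * H / h⌋₊ + 1 with hJ
  let S : ℕ → Set Plane := fun j => {v | |v 0 - t.1| ≤ M * h ∧
    t.2 - M * H + j * h ≤ v 1 ∧ v 1 ≤ t.2 - M * H + (j + 1) * h}
  have hcov : rectangle t (M * h) (M * H) ⊆ ⋃ j ∈ Finset.range J, S j := by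
    rintro v ⟨h0, h1⟩
    rw [abs_le] at h1
    have hnn : 0 ≤ (v 1 - t.2 + M * H) / h := div_nonneg (by linarith) hh.le
    refine mem_iUnion₂.2 ⟨⌊(v 1 - t.2 + M * H) / h⌋₊, ?_, h0, ?_, ?_⟩
    · rw [Finset.mem_range, hJ, Nat.lt_succ_iff]
      refine Nat.floor_le_floor ?_
      gcongr
      linarith
    · have := Nat.floor_le hnn
      rw [le_div_iff₀ hh] at this
      linarith
    · have := (Nat.lt_floor_add_one ((v 1 - t.2 + M * H) / h)).le
      rw [div_le_iff₀ hh] at this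
      linarith
  have hdiam : ∀ j, ediam (S j) ≤ ENNReal.ofReal ((2 * M + 1) * h) := by
    refine fun j => ediam_le fun v hv w hw => ?_
    rw [show (2 * M + 1) * h = 2 * (M * h) + h by ring]
    have hv0 := abs_le.1 hv.1
    have hw0 := abs_le.1 hw.1
    refine edist_le_of_abs_le (abs_le.2 ⟨by linarith, by linarith⟩) (abs_le.2 ⟨?_, ?_⟩)
    · linarith [hv.2.1, hw.2.2]
    · linarith [hv.2.2, hw.2.1]
  have hpos : 0 < (2 * M + 1) * h := by positivity
  have hH0 : 0 < H := hh.trans_le hH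
  have hS : ∀ j, content s r (S j) ≤ ENNReal.ofReal (((2 * M + 1) * h) ^ s) := fun j => by
    refine (OuterMeasure.mkMetric'.pre_le ((hdiam j).trans hr)).trans ?_
    rw [← ENNReal.ofReal_rpow_of_pos hpos]
    exact ENNReal.rpow_le_rpow (hdiam j) hs
  calc content s r (rectangle t (M * h) (M * H))
      ≤ content s r (⋃ j ∈ Finset.range J, S j) := measure_mono hcov
    _ ≤ ∑ j ∈ Finset.range J, content s r (S j) := measure_biUnion_finset_le _ _
    _ ≤ ∑ j ∈ Finset.range J, ENNReal.ofReal (((2 * M + 1) * h) ^ s) :=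
        Finset.sum_le_sum fun j _ => hS j
    _ = ENNReal.ofReal (J * ((2 * M + 1) * h) ^ s) := by
        rw [Finset.sum_const, Finset.card_range, nsmul_eq_mul,
          ENNReal.ofReal_mul (Nat.cast_nonneg _), ENNReal.ofReal_natCast]
    _ ≤ _ := by
        refine ENNReal.ofReal_le_ofReal ?_
        gcongr
        have h1 : (⌊2 * M * H / h⌋₊ : ℝ) ≤ 2 * M * H / h := Nat.floor_le (by positivity)
        have h2 : 1 ≤ H / h := (one_le_div hh).2 hH
        rw [hJ]
        push_cast
        calc (⌊2 * M * H / h⌋₊ : ℝ) + 1 ≤ 2 * M * H / h + H / h := add_le_add h1 h2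
          _ = _ := by ring

/-- The equation defining the critical exponent: the number of maps, the squares needed per unit of
eccentricity and the cost of a square balance exactly. -/
theorem mul_rpow_critDim {m : ℕ} {g l : ℝ} (hm : 0 < m) (hg : 0 < |g|) (hg1 : |g| < 1)
    (hl : 0 < |l|) : m * (|l| / |g| * |g| ^ critDim m g l) = 1 := by
  have hm' : (0 : ℝ) < m := by exact_mod_cast hm
  have hlog : Real.log |g| ≠ 0 := (Real.log_neg hg hg1).ne
  rw [critDim, Real.rpow_add hg, Real.rpow_one, Real.rpow_def_of_pos hg, one_div, Real.log_inv,
    show Real.log |g| * (Real.log (m * |l|) / -Real.log |g|) = -Real.log (m * |l|) by field_simp,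
    Real.exp_neg, Real.exp_log (by positivity)]
  field_simp

theorem pow_mul_content_rectangle_le {m : ℕ} {g l : ℝ} (hm : 0 < m) (hg : 0 < |g|) (hg1 : |g| < 1)
    (hgl : |g| ≤ |l|) (hs : 0 ≤ critDim m g l) {r : ℝ≥0∞} {M : ℝ} (hM : 0 < M) {n : ℕ}
    (hr : ENNReal.ofReal ((2 * M + 1) * |g| ^ n) ≤ r) (t : ℝ × ℝ) :
    (m : ℝ≥0∞) ^ n * content (critDim m g l) r (rectangle t (M * |g| ^ n) (M * |l| ^ n)) ≤
      ENNReal.ofReal ((2 * M + 1) * (2 * M + 1) ^ critDim m g l) := by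
  have hgn : 0 < |g| ^ n := by positivity
  have h := content_rectangle_le hs hM hgn (pow_le_pow_left₀ hg.le hgl n) hr t
  refine (mul_le_mul_right h _).trans_eq ?_
  rw [← ENNReal.ofReal_natCast, ← ENNReal.ofReal_pow (Nat.cast_nonneg _),
    ← ENNReal.ofReal_mul (by positivity)]
  congr 1
  have h1 : (|g| ^ n) ^ critDim m g l = (|g| ^ critDim m g l) ^ n := by
    rw [← Real.rpow_natCast, ← Real.rpow_natCast, ← Real.rpow_mul hg.le, ← Real.rpow_mul hg.le,
      mul_comm]
  have h2 := congrArg (· ^ n) (mul_rpow_critDim hm hg hg1 (hg.trans_le hgl))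
  simp only [mul_pow, div_pow, one_pow] at h2
  rw [Real.mul_rpow (by positivity) hgn.le, h1]
  linear_combination ((2 * M + 1) * (2 * M + 1) ^ critDim m g l) * h2


/-! ### Vanishing of the content and of the Hausdorff measure -/

/-- A finite supremum `b` of normalised contents cannot be positive: arbitrarily many subcylinders
can be replaced by one rectangle of bounded normalised cost. -/
theorem content_attractor_eq_zero {m : ℕ} {g l : ℝ} (hm : 0 < m) (hg : 0 < |g|) (hg1 : |g| < 1)
    (hgl : |g| ≤ |l|) (hs : 0 ≤ critDim m g l) (h : ∀ ε > 0, (g, l) ∈ overlapSet m ε)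
    {K : Set Plane} (hK : IsAttractor m g l K) {r : ℝ≥0∞} (hr : 0 < r) :
    content (critDim m g l) r K = 0 := by
  obtain ⟨B, hB0, hB⟩ := hK.exists_bound
  set μ := content (critDim m g l) r with hμ
  set C : ℝ≥0∞ := ENNReal.ofReal ((2 * (B + 1) + 1) * (2 * (B + 1) + 1) ^ critDim m g l) with hC
  have ht : Tendsto (fun n : ℕ => ENNReal.ofReal ((2 * (B + 1) + 1) * |g| ^ n)) atTop (𝓝 0) := by
    have := (tendsto_pow_atTop_nhds_zero_of_lt_one hg.le hg1).const_mul (2 * (B + 1) + 1)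
    rw [mul_zero] at this
    simpa using ENNReal.tendsto_ofReal this
  obtain ⟨n₀, hn₀⟩ := eventually_atTop.1 (ht.eventually (ge_mem_nhds hr))
  have hrect : ∀ n ≥ n₀, ∀ t,
      (m : ℝ≥0∞) ^ n * μ (rectangle t ((B + 1) * |g| ^ n) ((B + 1) * |l| ^ n)) ≤ C :=
    fun n hn t => pow_mul_content_rectangle_le hm hg hg1 hgl hs (by positivity) (hn₀ n hn) t
  -- The supremum runs over all translates, so subcylinders obey the same bound. The cutoff `n₀`
  -- keeps the covering boxes of diameter at most `r`.
  set b : ℝ≥0∞ := ⨆ n, ⨆ _ : n₀ ≤ n, ⨆ t, (m : ℝ≥0∞) ^ n * μ (cylinder g l K n t) with hb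
  have hcyl : ∀ n ≥ n₀, ∀ t, (m : ℝ≥0∞) ^ n * μ (cylinder g l K n t) ≤ b := fun n hn t =>
    le_iSup₂_of_le n hn (le_iSup (fun t => (m : ℝ≥0∞) ^ n * μ (cylinder g l K n t)) t)
  have hbC : b ≤ C := by
    refine iSup₂_le fun n hn => iSup_le fun t => ?_
    refine le_trans ?_ (hrect n hn t)
    gcongr
    exact cylinder_subset_rectangle hB (by simp) (by simp)
  have hb_top : b ≠ ⊤ := (hbC.trans_lt ENNReal.ofReal_lt_top).ne
  have hgain : ∀ k : ℕ, (2 : ℝ≥0∞) ^ k * b ≤ C := by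
    intro k
    -- Closeness with `ε = 1` suffices: all these cylinders fit in one rectangle with `B` enlarged
    -- to `B + 1`.
    obtain ⟨L, W, hW, hWε⟩ := exists_many_words hg hgl h k 1 one_pos
    obtain ⟨w₀, hw₀⟩ : W.Nonempty := Finset.card_pos.1 ((pow_pos two_pos k).trans_le hW)
    have hcard : (Wᶜ.card : ℝ≥0∞) + W.card = (m : ℝ≥0∞) ^ L := by
      have := Finset.card_compl_add_card W
      simp only [Fintype.card_fun, Fintype.card_fin] at this
      exact_mod_cast this
    have hsplit : ∀ n ≥ n₀, ∀ t, (m : ℝ≥0∞) ^ (n + L) * μ (cylinder g l K n t) ≤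
        Wᶜ.card * b + C := by
      intro n hn t
      let τ : (Fin L → Fin m) → ℝ × ℝ := fun w =>
        (t.1 + g ^ n * wordSum w g, t.2 + l ^ n * wordSum w l)
      have hsub : cylinder g l K n t ⊆ (⋃ w ∈ Wᶜ, cylinder g l K (n + L) (τ w)) ∪
          rectangle (τ w₀) ((B + 1) * |g| ^ (n + L)) ((B + 1) * |l| ^ (n + L)) := by
        refine (hK.cylinder_subset n L t).trans (iUnion_subset fun w => ?_)
        by_cases hw : w ∈ W
        · refine subset_union_of_subset_right (cylinder_subset_rectangle hB ?_ ?_) _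
          · rw [add_sub_add_left_eq_sub, ← mul_sub, abs_mul, abs_pow, pow_add, mul_left_comm]
            exact mul_le_mul_of_nonneg_left (hWε w hw w₀ hw₀).1 (by positivity)
          · rw [add_sub_add_left_eq_sub, ← mul_sub, abs_mul, abs_pow, pow_add, mul_left_comm]
            exact mul_le_mul_of_nonneg_left (hWε w hw w₀ hw₀).2 (by positivity)
        · refine subset_union_of_subset_left ?_ _
          exact subset_biUnion_of_mem (u := fun w => cylinder g l K (n + L) (τ w))
            (Finset.mem_coe.2 (Finset.mem_compl.2 hw))
      calc (m : ℝ≥0∞) ^ (n + L) * μ (cylinder g l K n t)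
          ≤ (m : ℝ≥0∞) ^ (n + L) * (∑ w ∈ Wᶜ, μ (cylinder g l K (n + L) (τ w)) +
              μ (rectangle (τ w₀) ((B + 1) * |g| ^ (n + L)) ((B + 1) * |l| ^ (n + L)))) := by
            gcongr
            refine (measure_mono hsub).trans ((measure_union_le _ _).trans ?_)
            gcongr
            exact measure_biUnion_finset_le _ _
        _ = ∑ w ∈ Wᶜ, (m : ℝ≥0∞) ^ (n + L) * μ (cylinder g l K (n + L) (τ w)) +
            (m : ℝ≥0∞) ^ (n + L) *
              μ (rectangle (τ w₀) ((B + 1) * |g| ^ (n + L)) ((B + 1) * |l| ^ (n + L))) := by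
            rw [mul_add, Finset.mul_sum]
        _ ≤ ∑ w ∈ Wᶜ, b + C := by
            gcongr with w hw
            · exact hcyl _ (by omega) _
            · exact hrect _ (by omega) _
        _ = _ := by rw [Finset.sum_const, nsmul_eq_mul]
    have hmul : (m : ℝ≥0∞) ^ L * b ≤ Wᶜ.card * b + C := by
      have hLb : (m : ℝ≥0∞) ^ L * b = ⨆ n, ⨆ _ : n₀ ≤ n, ⨆ t,
          (m : ℝ≥0∞) ^ L * ((m : ℝ≥0∞) ^ n * μ (cylinder g l K n t)) := by
        simp only [hb, ENNReal.mul_iSup]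
      rw [hLb]
      refine iSup₂_le fun n hn => iSup_le fun t => ?_
      rw [← mul_assoc, ← pow_add, add_comm L n]
      exact hsplit n hn t
    rw [← hcard, add_mul] at hmul
    -- Finiteness of `b` allows the contribution of the words outside `W` to be cancelled, leaving
    -- `W.card * b ≤ C`.
    have h2 := (ENNReal.add_le_add_iff_left
      (ENNReal.mul_ne_top (ENNReal.natCast_ne_top _) hb_top)).1 hmul
    refine le_trans ?_ h2
    gcongr
    exact_mod_cast hW
  have hb0 : b = 0 := by
    by_contra hne
    have htop : Tendsto (fun k : ℕ => (2 : ℝ≥0∞) ^ k * b) atTop (𝓝 (⊤ * b)) :=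
      ENNReal.Tendsto.mul_const
        (ENNReal.tendsto_pow_atTop_nhds_top_iff.2 ENNReal.one_lt_two) (Or.inr hb_top)
    rw [ENNReal.top_mul hne] at htop
    exact ENNReal.ofReal_ne_top (top_le_iff.1 (le_of_tendsto' htop hgain))
  have hzero : ∀ t, μ (cylinder g l K n₀ t) = 0 := fun t => by
    have h1 := hcyl n₀ le_rfl t
    rw [hb0, nonpos_iff_eq_zero, mul_eq_zero] at h1
    exact h1.resolve_left (pow_ne_zero _ (Nat.cast_ne_zero.2 hm.ne'))
  refine measure_mono_null (fun v hv => mem_iUnion.2 (hK.exists_word n₀ hv)) ?_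
  exact measure_iUnion_null fun w => hzero _

theorem hausdorffMeasure_attractor_eq_zero {m : ℕ} {g l : ℝ} (hm : 0 < m) (hg : 0 < |g|)
    (hg1 : |g| < 1) (hgl : |g| ≤ |l|) (hs : 0 ≤ critDim m g l)
    (h : ∀ ε > 0, (g, l) ∈ overlapSet m ε) {K : Set Plane} (hK : IsAttractor m g l K) :
    Measure.hausdorffMeasure (critDim m g l) K = 0 := by
  rw [Measure.hausdorffMeasure, ← OuterMeasure.coe_mkMetric]
  simp only [OuterMeasure.mkMetric, OuterMeasure.mkMetric', OuterMeasure.iSup_apply,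
    ENNReal.iSup_eq_zero]
  exact fun r hr => content_attractor_eq_zero hm hg hg1 hgl hs h hK hr

theorem overlapSet_mono (m : ℕ) {ε ε' : ℝ} (h : ε ≤ ε') : overlapSet m ε ⊆ overlapSet m ε' := by
  rintro p ⟨n, u, v, huv, h1, h2⟩
  exact ⟨n, u, v, huv, h1.trans_le (by gcongr), h2.trans_le (by gcongr)⟩

theorem critDim_nonneg {m : ℕ} {g l : ℝ} (hg : 0 < |g|) (hg1 : |g| < 1) (hl : 1 ≤ m * |l|) :
    0 ≤ critDim m g l :=
  add_nonneg zero_le_one (div_nonneg (Real.log_nonneg hl)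
    (Real.log_nonneg ((one_le_div hg).2 hg1.le)))

end SelfAffine

theorem mainTheorem9 (m : ℕ) (hm : 2 ≤ m) (R : Set (ℝ × ℝ))
    (hR : ∀ p ∈ R, |p.1| < |p.2| ∧ |p.2| < 1)
    (hT : SelfAffine.IsStarTransversal m R) :
    ∀ᵐ p ∂(volume : Measure (ℝ × ℝ)), p ∈ R →
      ∀ K : Set SelfAffine.Plane, SelfAffine.IsAttractor m p.1 p.2 K →
        Measure.hausdorffMeasure (SelfAffine.critDim m p.1 p.2) K = 0 := by
  -- A sequence of tolerances tending to zero keeps the exceptional set null; monotonicity in `ε`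
  -- then gives every tolerance.
  have h : ∀ᵐ p : ℝ × ℝ, ∀ j : ℕ, p ∈ R → p ∈ SelfAffine.overlapSet m (1 / ((j : ℝ) + 1)) :=
    ae_all_iff.2 fun j => SelfAffine.ae_mem_overlapSet
      (fun p hp => ⟨(hR p hp).1.trans (hR p hp).2, (hR p hp).2⟩) hT (by positivity)
  filter_upwards [h] with p hp hpR K hK
  obtain ⟨hgl, hl1⟩ := hR p hpR
  obtain ⟨c, hc, hz1, hz2, -, -⟩ := hT p hpR
  have hg := abs_pos.2 (SelfAffine.ne_zero_of_powerSum_eq_zero hc.2 hz1)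
  refine SelfAffine.hausdorffMeasure_attractor_eq_zero (by omega) hg (hgl.trans hl1) hgl.le
    (SelfAffine.critDim_nonneg hg (hgl.trans hl1)
      (SelfAffine.one_le_mul_abs_of_powerSum_eq_zero hc hl1 hz2)) (fun ε hε => ?_) hK
  obtain ⟨j, hj⟩ := exists_nat_one_div_lt hε
  exact SelfAffine.overlapSet_mono m hj.le (hp j hpR)
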